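/- Let $G=(V,E)$ be a finite simple bipartite graph with $e(G)$ edges, and let $x\in(-1,1)$. Let $\mathcal A(G,x)$ be the set of real symmetric positive definite $V\times V$ matrices $M$ with $M_{i,i}=1$ for every vertex $i$ and $M_{i,j}=x$ for every edge $(i,j)$ of $G$. Then there is a unique matrix $A_G(x)\in\mathcal A(G,x)$ whose determinant is maximal among all matrices in $\mathcal A(G,x)$, and $\tau(G,x):=\det A_G(x)$ satisfies $$\tau(G,x)\ \ge\ (1-x^2)^{e(G)}.$$ -/

import Mathlib

/-- `detFeasible G x` is the set of real symmetric positive definite `V × V` matrices with unit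
diagonal and with entry `x` at every edge of `G`.  (`Matrix.PosDef` includes symmetry.) -/
def detFeasible {V : Type*} (G : SimpleGraph V) (x : ℝ) : Set (Matrix V V ℝ) :=
  {M | M.PosDef ∧ (∀ i, M i i = 1) ∧ ∀ i j, G.Adj i j → M i j = x}

/-- `A` maximizes the determinant on `detFeasible G x`. -/
def IsDetMaximizer {V : Type*} [Fintype V] [DecidableEq V] (G : SimpleGraph V) (x : ℝ)
    (A : Matrix V V ℝ) : Prop :=
  A ∈ detFeasible G x ∧ ∀ M ∈ detFeasible G x, M.det ≤ A.det

open Classical in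
/-- The determinant-maximizing matrix of `detFeasible G x`
(with value `0` if there were no maximizer). -/
noncomputable def detMaximizer {V : Type*} [Fintype V] [DecidableEq V] (G : SimpleGraph V)
    (x : ℝ) : Matrix V V ℝ :=
  if h : ∃ A, IsDetMaximizer G x A then h.choose else 0

/-- `tau G x` is the determinant of the determinant-maximizing matrix. -/
noncomputable def tau {V : Type*} [Fintype V] [DecidableEq V] (G : SimpleGraph V) (x : ℝ) : ℝ :=
  (detMaximizer G x).det

/-! Conjugating by the signs of a two-colouring turns `x` into `-x`, so `0 ≤ x < 1` may be assumed;
the bound then holds for every loopless edge set, by deletion-contraction on the number of edges. It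
suffices to exhibit one feasible matrix with large determinant.

Let `t` be the bound for one edge fewer. Suppose that, for some edge `ij`, a completion `N` of the
deletion has determinant at least `t` and `N i j ≤ x`. The pullback of a completion `L` of the
contraction has entry `1` at `ij`, so some convex combination has entry `x` there. Taking the Schur
complement of the `ij` block costs exactly `1 - x ^ 2` (`le_det_combo_contraction`). Otherwise every
deletion has such a completion with entry above `x`, and a weighted average of these with the
identity has entry `x` on all edges, with no loss (`exists_isEdgeCompletion_of_forall_lt`). Both
cases rest on quasi-concavity of the determinant. The maximizer exists by compactness and is unique
by strictness in AM-GM. -/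

set_option linter.unusedSectionVars false

universe u

open Matrix

namespace Matrix

variable {n m : Type*} [Fintype n] [DecidableEq n] [Fintype m] [DecidableEq m]

/-! ### Determinant inequalities by simultaneous diagonalization -/

/-- A real symmetric matrix is orthogonally diagonalizable. -/
theorem IsHermitian.exists_transpose_mul_diagonal_mul {A : Matrix n n ℝ} (hA : A.IsHermitian) :
    ∃ (U : Matrix n n ℝ) (μ : n → ℝ), Uᵀ * U = 1 ∧ A = Uᵀ * diagonal μ * U := by
  refine ⟨(star (hA.eigenvectorUnitary : Matrix n n ℝ)), hA.eigenvalues, ?_, ?_⟩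
  · rw [star_eq_conjTranspose, conjTranspose_eq_transpose_of_trivial, transpose_transpose,
      ← conjTranspose_eq_transpose_of_trivial, ← star_eq_conjTranspose]
    exact Unitary.coe_mul_star_self _
  · have h := hA.spectral_theorem
    rw [Unitary.conjStarAlgAut_apply] at h
    conv_lhs => rw [h]
    simp [star_eq_conjTranspose, conjTranspose_eq_transpose_of_trivial]

/-- Simultaneous diagonalization by congruence of a positive definite matrix and a symmetric one. -/
theorem PosDef.exists_simultaneous_diagonal {A B : Matrix n n ℝ} (hA : A.PosDef)
    (hB : B.IsHermitian) :
    ∃ (C : Matrix n n ℝ) (μ : n → ℝ), IsUnit C ∧ A = Cᵀ * C ∧ B = Cᵀ * diagonal μ * C := by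
  obtain ⟨U, l, hU, hAU⟩ := hA.isHermitian.exists_transpose_mul_diagonal_mul
  have hUu : IsUnit U := IsUnit.of_mul_eq_one_right _ hU
  have hl : ∀ i, 0 < l i := by
    have h := hA
    rw [hAU, ← conjTranspose_eq_transpose_of_trivial, ← star_eq_conjTranspose,
      hUu.posDef_star_left_conjugate_iff, posDef_diagonal_iff] at h
    exact h
  set S : Matrix n n ℝ := diagonal (fun i => √(l i)) * U with hS
  have hSu : IsUnit S := by
    refine IsUnit.mul ?_ hUu
    rw [isUnit_diagonal, Pi.isUnit_iff]
    exact fun i => (Real.sqrt_pos.2 (hl i)).ne'.isUnit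
  have hAS : A = Sᵀ * S := by
    rw [hS, transpose_mul, diagonal_transpose, hAU]
    have : diagonal l = diagonal (fun i => √(l i)) * diagonal (fun i => √(l i)) := by
      rw [diagonal_mul_diagonal]
      congr 1; ext i; exact (Real.mul_self_sqrt (hl i).le).symm
    rw [this]; simp only [Matrix.mul_assoc]
  have hdet : IsUnit S.det := (isUnit_iff_isUnit_det _).1 hSu
  have hH : (S⁻¹ᵀ * B * S⁻¹).IsHermitian := by
    have := isHermitian_conjTranspose_mul_mul (S⁻¹) hB
    rwa [conjTranspose_eq_transpose_of_trivial] at this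
  obtain ⟨W, μ, hW, hBW⟩ := hH.exists_transpose_mul_diagonal_mul
  have hWu : IsUnit W := IsUnit.of_mul_eq_one_right _ hW
  refine ⟨W * S, μ, hWu.mul hSu, ?_, ?_⟩
  · rw [transpose_mul, hAS, Matrix.mul_assoc, ← Matrix.mul_assoc Wᵀ, hW, Matrix.one_mul]
  · have h1 : S⁻¹ * S = 1 := nonsing_inv_mul _ hdet
    have h2 : Sᵀ * S⁻¹ᵀ = 1 := by rw [← transpose_mul, h1, transpose_one]
    calc B = (Sᵀ * S⁻¹ᵀ) * B * (S⁻¹ * S) := by rw [h1, h2, Matrix.one_mul, Matrix.mul_one]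
      _ = Sᵀ * (S⁻¹ᵀ * B * S⁻¹) * S := by simp only [Matrix.mul_assoc]
      _ = _ := by rw [hBW, transpose_mul W S]; simp only [Matrix.mul_assoc]

theorem det_smul_add_smul_of_diagonal {C : Matrix n n ℝ} {μ : n → ℝ} (a b : ℝ) :
    (a • (Cᵀ * C) + b • (Cᵀ * diagonal μ * C)).det = C.det ^ 2 * ∏ i, (a + b * μ i) := by
  have : a • (Cᵀ * C) + b • (Cᵀ * diagonal μ * C)
      = Cᵀ * diagonal (fun i => a + b * μ i) * C := by
    have h : diagonal (fun i => a + b * μ i) = a • (1 : Matrix n n ℝ) + b • diagonal μ := by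
      ext i j; by_cases h : i = j <;> simp [h]
    rw [h, Matrix.mul_add, Matrix.add_mul]; simp
  rw [this, det_mul, det_mul, det_transpose, det_diagonal]; ring

theorem posSemidef_of_transpose_mul_diagonal {C : Matrix n n ℝ} {μ : n → ℝ} (hC : IsUnit C)
    (h : (Cᵀ * diagonal μ * C).PosSemidef) (i : n) : 0 ≤ μ i := by
  rw [← conjTranspose_eq_transpose_of_trivial, ← star_eq_conjTranspose,
    hC.posSemidef_star_left_conjugate_iff, posSemidef_diagonal_iff] at h
  exact h i

theorem posDef_of_transpose_mul_diagonal {C : Matrix n n ℝ} {μ : n → ℝ} (hC : IsUnit C)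
    (h : (Cᵀ * diagonal μ * C).PosDef) (i : n) : 0 < μ i := by
  rw [← conjTranspose_eq_transpose_of_trivial, ← star_eq_conjTranspose,
    hC.posDef_star_left_conjugate_iff, posDef_diagonal_iff] at h
  exact h i

/-- The determinant is monotone on positive definite matrices. -/
theorem PosDef.det_le_det_add {A B : Matrix n n ℝ} (hA : A.PosDef) (hB : B.PosSemidef) :
    A.det ≤ (A + B).det := by
  obtain ⟨C, μ, hC, rfl, rfl⟩ := hA.exists_simultaneous_diagonal hB.isHermitian
  have hμ := posSemidef_of_transpose_mul_diagonal hC hB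
  have h := det_smul_add_smul_of_diagonal (C := C) (μ := μ) 1 1
  rw [one_smul, one_smul] at h
  rw [h, det_mul, det_transpose, ← sq]
  refine le_mul_of_one_le_right (sq_nonneg _) ?_
  calc (1 : ℝ) = ∏ _i : n, 1 := by simp
    _ ≤ _ := Finset.prod_le_prod (fun _ _ => zero_le_one) fun i _ => by linarith [hμ i]

/-- Quasi-concavity of the determinant on positive definite matrices. -/
theorem PosDef.le_det_convexCombo {A B : Matrix n n ℝ} (hA : A.PosDef) (hB : B.PosDef) {a b t : ℝ}
    (ha : 0 ≤ a) (hb : 0 ≤ b) (hab : a + b = 1) (htA : t ≤ A.det) (htB : t ≤ B.det) :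
    t ≤ (a • A + b • B).det := by
  obtain ⟨C, μ, hC, rfl, rfl⟩ := hA.exists_simultaneous_diagonal hB.isHermitian
  have hμ := posDef_of_transpose_mul_diagonal hC hB
  rw [det_smul_add_smul_of_diagonal]
  have h1 : (Cᵀ * C).det = C.det ^ 2 := by rw [det_mul, det_transpose, ← sq]
  have h2 : (Cᵀ * diagonal μ * C).det = C.det ^ 2 * ∏ i, μ i := by
    rw [det_mul, det_mul, det_transpose, det_diagonal]; ring
  rw [h1] at htA
  rw [h2] at htB
  have hP : 0 < ∏ i, μ i := Finset.prod_pos fun i _ => hμ i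
  -- Weighted AM-GM for `1` and `μ i`. Times `C.det ^ 2`, the left side is the weighted geometric
  -- mean of the two determinants, hence at least the smaller one.
  have hag : (∏ i, μ i) ^ b ≤ ∏ i, (a + b * μ i) := by
    rw [← Real.finsetProd_rpow _ _ (fun i _ => (hμ i).le)]
    refine Finset.prod_le_prod (fun i _ => Real.rpow_nonneg (hμ i).le _) fun i _ => ?_
    have := Real.geom_mean_le_arith_mean2_weighted ha hb zero_le_one (hμ i).le hab
    simpa using this
  refine le_trans ?_ (mul_le_mul_of_nonneg_left hag (sq_nonneg _))
  rcases le_total 1 (∏ i, μ i) with h | h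
  · exact htA.trans (le_mul_of_one_le_right (sq_nonneg _) (Real.one_le_rpow h hb))
  · refine htB.trans (mul_le_mul_of_nonneg_left ?_ (sq_nonneg _))
    calc ∏ i, μ i = (∏ i, μ i) ^ (1 : ℝ) := (Real.rpow_one _).symm
      _ ≤ _ := Real.rpow_le_rpow_of_exponent_ge hP h (by linarith)

/-- Two positive definite matrices whose midpoint has no larger determinant are equal. -/
theorem PosDef.eq_of_det_midpoint_le {A B : Matrix n n ℝ} (hA : A.PosDef) (hB : B.PosDef)
    (hAB : A.det ≤ B.det) (h : ((1 / 2 : ℝ) • A + (1 / 2 : ℝ) • B).det ≤ A.det) : A = B := by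
  obtain ⟨C, μ, hC, rfl, rfl⟩ := hA.exists_simultaneous_diagonal hB.isHermitian
  have hμ := posDef_of_transpose_mul_diagonal hC hB
  rw [det_smul_add_smul_of_diagonal] at h
  have h1 : (Cᵀ * C).det = C.det ^ 2 := by rw [det_mul, det_transpose, ← sq]
  have h2 : (Cᵀ * diagonal μ * C).det = C.det ^ 2 * ∏ i, μ i := by
    rw [det_mul, det_mul, det_transpose, det_diagonal]; ring
  have hd : 0 < C.det ^ 2 := h1 ▸ hA.det_pos
  rw [h1] at h hAB
  rw [h2] at hAB
  have hP : 1 ≤ ∏ i, μ i := le_of_mul_le_mul_left (by simpa using hAB) hd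
  have hM : ∏ i, (1 / 2 + 1 / 2 * μ i) ≤ 1 := le_of_mul_le_mul_left (by simpa using h) hd
  have hone : ∀ i, μ i = 1 := by
    by_contra hne
    push Not at hne
    obtain ⟨k, hk⟩ := hne
    -- AM-GM for `1` and `μ i` is strict at `k`, since `μ k ≠ 1`.
    have hlt : ∏ i, √(μ i) < ∏ i, (1 / 2 + 1 / 2 * μ i) := by
      refine Finset.prod_lt_prod (fun i _ => Real.sqrt_pos.2 (hμ i)) (fun i _ => ?_)
        ⟨k, Finset.mem_univ _, ?_⟩
      · nlinarith [Real.sq_sqrt (hμ i).le, sq_nonneg (√(μ i) - 1)]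
      · have : √(μ k) - 1 ≠ 0 := fun h0 => hk (by
          have : √(μ k) = 1 := by linarith
          rw [← Real.sq_sqrt (hμ k).le, this, one_pow])
        nlinarith [Real.sq_sqrt (hμ k).le, sq_pos_of_ne_zero this]
    have hs : 1 ≤ ∏ i, √(μ i) := by
      have hnn : 0 ≤ ∏ i, √(μ i) := Finset.prod_nonneg fun i _ => Real.sqrt_nonneg _
      have : (∏ i, √(μ i)) ^ 2 = ∏ i, μ i := by
        rw [← Finset.prod_pow]; exact Finset.prod_congr rfl fun i _ => Real.sq_sqrt (hμ i).le
      nlinarith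
    linarith
  have : μ = 1 := funext hone
  rw [this]; simp

/-! ### Schur complements with a free shift, and the contraction bound -/

variable {k : Type*} [Fintype k] [DecidableEq k]

/-- The lower right block of the congruence of `fromBlocks A B Bᵀ D` by the unipotent matrix with
upper right block `-X`; for `X = A⁻¹ * B` it is the Schur complement of `A`. -/
def shiftedSchur (A : Matrix m m ℝ) (B : Matrix m n ℝ) (D : Matrix n n ℝ) (X : Matrix m n ℝ) :
    Matrix n n ℝ :=
  D - Bᵀ * X - Xᵀ * B + Xᵀ * A * X

/-- The true Schur complement is not linear in the blocks; fixing the shift `X` makes it so, and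
convex combinations then pass through. -/
theorem shiftedSchur_combo (A A' : Matrix m m ℝ) (B B' : Matrix m n ℝ) (D D' : Matrix n n ℝ)
    (X : Matrix m n ℝ) (a b : ℝ) :
    shiftedSchur (a • A + b • A') (a • B + b • B') (a • D + b • D') X
      = a • shiftedSchur A B D X + b • shiftedSchur A' B' D' X := by
  simp only [shiftedSchur, transpose_add, transpose_smul, Matrix.mul_add, Matrix.add_mul,
    Matrix.mul_smul, Matrix.smul_mul, smul_add, smul_sub]
  abel

theorem shiftedSchur_mul_left (A : Matrix k k ℝ) (B : Matrix k n ℝ) (D : Matrix n n ℝ)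
    (X : Matrix m n ℝ) (F : Matrix k m ℝ) :
    shiftedSchur (Fᵀ * A * F) (Fᵀ * B) D X = shiftedSchur A B D (F * X) := by
  simp only [shiftedSchur, transpose_mul, transpose_transpose, Matrix.mul_assoc]

/-- Completing the square: the excess over the Schur complement is positive semidefinite and
vanishes at `X = A⁻¹ * B`. So the true Schur complement is the smallest. -/
theorem shiftedSchur_eq_add {A : Matrix m m ℝ} (B : Matrix m n ℝ) (D : Matrix n n ℝ)
    (X : Matrix m n ℝ) (hA : A.PosDef) :
    shiftedSchur A B D X
      = (D - Bᵀ * A⁻¹ * B) + (X - A⁻¹ * B)ᵀ * A * (X - A⁻¹ * B) := by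
  have hu : IsUnit A.det := hA.det_pos.ne'.isUnit
  have hAt : Aᵀ = A := by
    rw [← conjTranspose_eq_transpose_of_trivial]; exact hA.isHermitian
  have h1 : Bᵀ * A⁻¹ * A * X = Bᵀ * X := by
    rw [Matrix.mul_assoc Bᵀ, nonsing_inv_mul _ hu, Matrix.mul_one]
  have h2 : Xᵀ * A * (A⁻¹ * B) = Xᵀ * B := by
    rw [Matrix.mul_assoc, ← Matrix.mul_assoc A, mul_nonsing_inv _ hu, Matrix.one_mul]
  have h3 : Bᵀ * A⁻¹ * A * (A⁻¹ * B) = Bᵀ * A⁻¹ * B := by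
    rw [Matrix.mul_assoc Bᵀ, nonsing_inv_mul _ hu, Matrix.mul_one, Matrix.mul_assoc]
  rw [transpose_sub, transpose_mul, transpose_nonsing_inv, hAt, Matrix.sub_mul, Matrix.sub_mul,
    Matrix.mul_sub, Matrix.mul_sub, h1, h2, h3, shiftedSchur]
  abel

section

variable {A : Matrix m m ℝ} {B : Matrix m n ℝ} {D : Matrix n n ℝ}

theorem PosDef.toBlocks₁₁ (h : (fromBlocks A B Bᵀ D).PosDef) : A.PosDef := by
  have := h.submatrix (e := (Sum.inl : m → m ⊕ n)) Sum.inl_injective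
  exact this

theorem PosDef.schur (h : (fromBlocks A B Bᵀ D).PosDef) : (D - Bᵀ * A⁻¹ * B).PosDef := by
  have hA := h.toBlocks₁₁
  have : Invertible A := hA.isUnit.invertible
  have hs : (D - Bᵀ * A⁻¹ * B).PosSemidef := by
    have := (PosDef.fromBlocks₁₁ (A := A) B D hA).1
      (by simpa [conjTranspose_eq_transpose_of_trivial] using h.posSemidef)
    simpa [conjTranspose_eq_transpose_of_trivial] using this
  rw [hs.posDef_iff_det_ne_zero]
  have hd := h.det_pos
  rw [det_fromBlocks₁₁, invOf_eq_nonsing_inv] at hd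
  exact fun h0 => by simp [h0] at hd

theorem PosDef.shiftedSchur (h : (fromBlocks A B Bᵀ D).PosDef) (X : Matrix m n ℝ) :
    (shiftedSchur A B D X).PosDef := by
  rw [shiftedSchur_eq_add B D X h.toBlocks₁₁]
  refine h.schur.add_posSemidef ?_
  have := h.toBlocks₁₁.posSemidef.conjTranspose_mul_mul_same (X - A⁻¹ * B)
  rwa [conjTranspose_eq_transpose_of_trivial] at this

theorem PosDef.det_fromBlocks_eq (h : (fromBlocks A B Bᵀ D).PosDef) :
    (fromBlocks A B Bᵀ D).det = A.det * (Matrix.shiftedSchur A B D (A⁻¹ * B)).det := by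
  have : Invertible A := h.toBlocks₁₁.isUnit.invertible
  rw [shiftedSchur_eq_add B D _ h.toBlocks₁₁, det_fromBlocks₁₁, invOf_eq_nonsing_inv]
  simp

theorem PosDef.det_fromBlocks_le (h : (fromBlocks A B Bᵀ D).PosDef) (X : Matrix m n ℝ) :
    (fromBlocks A B Bᵀ D).det ≤ A.det * (Matrix.shiftedSchur A B D X).det := by
  have : Invertible A := h.toBlocks₁₁.isUnit.invertible
  rw [shiftedSchur_eq_add B D _ h.toBlocks₁₁, det_fromBlocks₁₁, invOf_eq_nonsing_inv]
  refine mul_le_mul_of_nonneg_left ?_ h.toBlocks₁₁.det_pos.le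
  refine h.schur.det_le_det_add ?_
  have := h.toBlocks₁₁.posSemidef.conjTranspose_mul_mul_same (X - A⁻¹ * B)
  rwa [conjTranspose_eq_transpose_of_trivial] at this

end

/-- If `N` has unit diagonal, an off-diagonal entry `y` at the pair `m = Fin 2`, and `L` has unit
diagonal on the contraction of that pair to a point, then the convex combination of `N` and the
pullback of `L` having entry `x` at the pair satisfies a deletion-contraction bound. -/
theorem le_det_combo_contraction {N : Matrix (Fin 2 ⊕ n) (Fin 2 ⊕ n) ℝ}
    {L : Matrix (Unit ⊕ n) (Unit ⊕ n) ℝ} (hN : N.PosDef) (hL : L.PosDef) {x y θ t : ℝ}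
    (hN1 : ∀ i : Fin 2, N (Sum.inl i) (Sum.inl i) = 1) (hNy : N (Sum.inl 0) (Sum.inl 1) = y)
    (hL1 : L (Sum.inl ()) (Sum.inl ()) = 1) (hθ0 : 0 ≤ θ) (hθ1 : θ < 1)
    (hx : (1 - θ) * y + θ = x) (hx1 : x ^ 2 ≤ 1) (hNt : t ≤ N.det) (hLt : t ≤ L.det) :
    (1 - x ^ 2) * t ≤ ((1 - θ) • N + θ • L.submatrix (Sum.map (fun _ : Fin 2 => ()) id)
      (Sum.map (fun _ : Fin 2 => ()) id)).det := by
  set φ : Fin 2 ⊕ n → Unit ⊕ n := Sum.map (fun _ : Fin 2 => ()) id with hφ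
  have hLs : (L.submatrix φ φ).PosSemidef := hL.posSemidef.submatrix φ
  have hM : ((1 - θ) • N + θ • L.submatrix φ φ).PosDef :=
    (hN.smul (by linarith)).add_posSemidef (hLs.smul hθ0)
  have symmN : N.toBlocks₂₁ = N.toBlocks₁₂ᵀ := by
    ext i j; exact (hN.isHermitian.apply _ _).symm
  have symmL : L.toBlocks₂₁ = L.toBlocks₁₂ᵀ := by
    ext i j; exact (hL.isHermitian.apply _ _).symm
  obtain ⟨A, B, D, rfl⟩ : ∃ A B D, N = fromBlocks A B Bᵀ D :=
    ⟨_, _, _, by conv_lhs => rw [← fromBlocks_toBlocks N, symmN]⟩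
  obtain ⟨a, b, d, rfl⟩ : ∃ a b d, L = fromBlocks a b bᵀ d :=
    ⟨_, _, _, by conv_lhs => rw [← fromBlocks_toBlocks L, symmL]⟩
  -- Pulling back along the collapse is congruence of the first block by the all-ones row `F`.
  set F : Matrix Unit (Fin 2) ℝ := of fun _ _ => 1 with hF
  have hsub : (fromBlocks a b bᵀ d).submatrix φ φ
      = fromBlocks (Fᵀ * a * F) (Fᵀ * b) (Fᵀ * b)ᵀ d := by
    ext (i | i) (j | j) <;> simp [hφ, hF, Matrix.mul_apply]
  have hcomb : (1 - θ) • fromBlocks A B Bᵀ D + θ • (fromBlocks a b bᵀ d).submatrix φ φ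
      = fromBlocks ((1 - θ) • A + θ • (Fᵀ * a * F)) ((1 - θ) • B + θ • (Fᵀ * b))
        ((1 - θ) • B + θ • (Fᵀ * b))ᵀ ((1 - θ) • D + θ • d) := by
    rw [hsub, fromBlocks_smul, fromBlocks_smul, fromBlocks_add, transpose_add, transpose_smul,
      transpose_smul]
  rw [hcomb] at hM ⊢
  rw [hM.det_fromBlocks_eq, shiftedSchur_combo, shiftedSchur_mul_left]
  -- The optimal shift for the combination; for `N` and `L` it (or `F * X`) is merely admissible,
  -- which gives inequalities in the needed direction.
  set X := ((1 - θ) • A + θ • (Fᵀ * a * F))⁻¹ * ((1 - θ) • B + θ • (Fᵀ * b))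
  simp only [fromBlocks_apply₁₁] at hN1 hNy hL1
  have hNy' : A 1 0 = y := by rw [← hNy]; exact hN.toBlocks₁₁.isHermitian.apply _ _
  have hdet : ((1 - θ) • A + θ • (Fᵀ * a * F)).det = 1 - x ^ 2 := by
    simp [det_fin_two, hF, Matrix.mul_apply, hN1, hNy, hNy', hL1, ← hx]; ring
  rw [hdet]
  refine mul_le_mul_of_nonneg_left ?_ (by linarith)
  refine (hN.shiftedSchur X).le_det_convexCombo (hL.shiftedSchur (F * X)) (by linarith) hθ0
    (by ring) ?_ ?_
  -- The block of `N` has determinant `1 - y ^ 2 ≤ 1`; that of `L` is the scalar `1`.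
  · refine hNt.trans ((hN.det_fromBlocks_le X).trans ?_)
    refine mul_le_of_le_one_left (hN.shiftedSchur X).det_pos.le ?_
    simp only [det_fin_two, hN1, hNy, hNy']
    nlinarith [sq_nonneg y]
  · refine hLt.trans ((hL.det_fromBlocks_le (F * X)).trans ?_)
    simp [hL1]

end Matrix

/-! ### Edge completions by deletion and contraction -/

section Completion

/-- `IsEdgeCompletion E x t M` says that `M` is a correlation matrix with entry `x` at every pair
in `E` and determinant at least `t`. -/
structure IsEdgeCompletion {V : Type*} [Fintype V] [DecidableEq V] (E : Finset (Sym2 V)) (x t : ℝ)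
    (M : Matrix V V ℝ) : Prop where
  posDef : M.PosDef
  diag : ∀ i, M i i = 1
  edge : ∀ i j, s(i, j) ∈ E → M i j = x
  le_det : t ≤ M.det

variable {V : Type*} [Fintype V] [DecidableEq V] {E : Finset (Sym2 V)} {x t : ℝ}

theorem convex_posDef_le_det (t : ℝ) :
    Convex ℝ {M : Matrix V V ℝ | M.PosDef ∧ (∀ i, M i i = 1) ∧ t ≤ M.det} := by
  rintro A ⟨hA, hA1, hAt⟩ B ⟨hB, hB1, hBt⟩ a b ha hb hab
  refine ⟨?_, fun i => by simp [hA1, hB1, hab], hA.le_det_convexCombo hB ha hb hab hAt hBt⟩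
  rcases ha.eq_or_lt with rfl | ha'
  · obtain rfl : b = 1 := by linarith
    simpa using hB
  · exact (hA.smul ha').add_posSemidef (hB.posSemidef.smul hb)

/-- If deleting any edge can be completed so that the deleted entry exceeds `x`, then averaging
with the identity matrix gives a completion with entry `x` at every edge. -/
theorem exists_isEdgeCompletion_of_forall_lt (hx : 0 ≤ x) (ht : t ≤ 1)
    (h : ∀ e ∈ E, ¬ e.IsDiag) (N : Sym2 V → Matrix V V ℝ) (y : Sym2 V → ℝ)
    (hN : ∀ e ∈ E, IsEdgeCompletion (E.erase e) x t (N e))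
    (hy : ∀ e ∈ E, x < y e) (hNy : ∀ i j, s(i, j) ∈ E → N s(i, j) i j = y s(i, j)) :
    ∃ M, IsEdgeCompletion E x t M := by
  -- With weight `1` on the identity, entry `x` at `e` amounts to `c e * (y e - x) = x`.
  set c : Sym2 V → ℝ := fun e => x / (y e - x) with hc
  have hc0 : ∀ e ∈ E, 0 ≤ c e := fun e he => div_nonneg hx (by linarith [hy e he])
  have hS : 0 < 1 + ∑ e ∈ E, c e := by linarith [Finset.sum_nonneg hc0]
  set w : Option (Sym2 V) → ℝ := fun o => o.elim 1 c / (1 + ∑ e ∈ E, c e) with hw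
  set P : Option (Sym2 V) → Matrix V V ℝ := fun o => o.elim 1 N with hP
  have hw1 : ∑ o ∈ E.insertNone, w o = 1 := by
    rw [hw, ← Finset.sum_div, Finset.sum_insertNone]
    exact div_self hS.ne'
  have hmem := (convex_posDef_le_det (V := V) t).sum_mem (t := E.insertNone) (w := w) (z := P)
    (by
      rintro (_ | e) he
      · exact div_nonneg zero_le_one hS.le
      · exact div_nonneg (hc0 e (by simpa using he)) hS.le) hw1
    (by
      rintro (_ | e) he
      · exact ⟨PosDef.one, fun i => by simp [hP], by simpa [hP] using ht⟩
      · have := hN e (by simpa using he)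
        exact ⟨this.posDef, this.diag, this.le_det⟩)
  refine ⟨_, hmem.1, hmem.2.1, fun i j hij => ?_, hmem.2.2⟩
  have hne : i ≠ j := fun h0 => h _ hij (by simpa using h0)
  have hyx : y s(i, j) - x ≠ 0 := by linarith [hy _ hij]
  rw [Finset.sum_insertNone, Matrix.add_apply, Matrix.sum_apply]
  have h0 : (w none • P none) i j = 0 := by simp [hP, hne]
  have h1 : ∀ e ∈ E, (w (some e) • P (some e)) i j
      = (c e * x + if e = s(i, j) then x else 0) / (1 + ∑ e ∈ E, c e) := by
    intro e he
    rw [Matrix.smul_apply, smul_eq_mul]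
    simp only [hw, hP, Option.elim]
    split_ifs with heq
    · subst heq
      rw [hNy i j hij]
      simp only [hc]
      field_simp
      ring
    · rw [(hN e he).edge i j (Finset.mem_erase.2 ⟨fun h' => heq h'.symm, hij⟩)]
      ring
  rw [h0, Finset.sum_congr rfl h1, ← Finset.sum_div, Finset.sum_add_distrib, ← Finset.sum_mul,
    Finset.sum_ite_eq' E, if_pos hij, zero_add, div_eq_iff hS.ne']
  ring

/-- A type with two marked distinct points splits as a sum of the pair and its complement. -/
theorem exists_equiv_fin_two_sum {i j : V} (hij : i ≠ j) :
    ∃ e : Fin 2 ⊕ {v : V // v ≠ i ∧ v ≠ j} ≃ V, e (Sum.inl 0) = i ∧ e (Sum.inl 1) = j := by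
  refine ⟨Equiv.ofBijective (Sum.elim ![i, j] Subtype.val) ⟨?_, ?_⟩, rfl, rfl⟩
  · refine Function.Injective.sumElim ?_ Subtype.val_injective ?_
    · intro a b; fin_cases a <;> fin_cases b <;> simp [hij, hij.symm]
    · rintro a ⟨v, hv⟩; fin_cases a
      · exact hv.1.symm
      · exact hv.2.symm
  · intro v
    by_cases h1 : v = i
    · exact ⟨Sum.inl 0, h1.symm⟩
    by_cases h2 : v = j
    · exact ⟨Sum.inl 1, h2.symm⟩
    · exact ⟨Sum.inr ⟨v, h1, h2⟩, rfl⟩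

/-- Collapsing the pair `Fin 2` to a point. -/
abbrev collapsePair (W : Type*) : Fin 2 ⊕ W → Unit ⊕ W := Sum.map (fun _ => ()) id

/-- Only the contracted pair becomes a loop, so contraction keeps the remaining edges loopless. -/
theorem collapsePair_eq {W : Type*} {a b : Fin 2 ⊕ W} (h : collapsePair W a = collapsePair W b)
    (hab : a ≠ b) : s(a, b) = s(Sum.inl 0, Sum.inl 1) := by
  rcases a with a | a <;> rcases b with b | b <;> simp at h
  · fin_cases a <;> fin_cases b <;> simp at hab ⊢
  · exact absurd (by rw [h]) hab

/-- The deletion-contraction step. -/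
theorem exists_isEdgeCompletion_of_contraction (hx : 0 ≤ x) (hx1 : x < 1) {i j : V}
    {W : Type*} [Fintype W] [DecidableEq W] (e : Fin 2 ⊕ W ≃ V) (hei : e (Sum.inl 0) = i)
    (hej : e (Sum.inl 1) = j) {N : Matrix V V ℝ} (hN : IsEdgeCompletion (E.erase s(i, j)) x t N)
    (hy : N i j ≤ x) {L : Matrix (Unit ⊕ W) _ ℝ}
    (hL : IsEdgeCompletion
      ((E.erase s(i, j)).image (Sym2.map (collapsePair _ ∘ e.symm))) x t L) :
    ∃ M, IsEdgeCompletion E x ((1 - x ^ 2) * t) M := by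
  set y := N i j with hyd
  set θ : ℝ := (x - y) / (1 - y) with hθ
  have hy1 : 0 < 1 - y := by linarith
  have hθ0 : 0 ≤ θ := div_nonneg (by linarith) hy1.le
  have hθ1 : θ < 1 := by rw [hθ, div_lt_one hy1]; linarith
  have hθx : (1 - θ) * y + θ = x := by rw [hθ]; field_simp; ring
  set φ := collapsePair W ∘ e.symm with hφ
  have hdet := le_det_combo_contraction (N := N.submatrix e e) (L := L) (x := x) (y := y) (t := t)
    (hN.posDef.submatrix e.injective) hL.posDef (fun k => hN.diag _) (by simp [hei, hej, hyd])
    (hL.diag _) hθ0 hθ1 hθx (by nlinarith) (by rw [det_submatrix_equiv_self]; exact hN.le_det)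
    hL.le_det
  have hsub : ((1 - θ) • N.submatrix e e + θ • L.submatrix (collapsePair _) (collapsePair _))
      = ((1 - θ) • N + θ • L.submatrix φ φ).submatrix e e := by
    ext a b; simp [hφ]
  rw [hsub, det_submatrix_equiv_self] at hdet
  refine ⟨_, (hN.posDef.smul (by linarith)).add_posSemidef
    ((hL.posDef.posSemidef.submatrix φ).smul hθ0), fun k => ?_, fun k l hkl => ?_, hdet⟩
  · simp [hN.diag, hL.diag]
  · by_cases hs : s(k, l) = s(i, j)
    · have hφij : φ i = φ j := by
        rw [← hei, ← hej]; simp [hφ]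
      have hval : ((1 - θ) • N + θ • L.submatrix φ φ) i j = x := by
        simp [hφij, hL.diag, ← hyd, hθx]
      have hH : ((1 - θ) • N + θ • L.submatrix φ φ).IsHermitian :=
        (hN.posDef.smul (by linarith : 0 < 1 - θ)).isHermitian.add
          ((hL.posDef.posSemidef.submatrix φ).smul hθ0).isHermitian
      rcases Sym2.eq_iff.1 hs with ⟨rfl, rfl⟩ | ⟨rfl, rfl⟩
      · exact hval
      · rw [← hval]; exact hH.apply _ _
    · have hmem : s(k, l) ∈ E.erase s(i, j) := Finset.mem_erase.2 ⟨hs, hkl⟩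
      have h1 := hN.edge k l hmem
      have h2 : L (φ k) (φ l) = x := hL.edge _ _ (Finset.mem_image_of_mem (Sym2.map φ) hmem)
      simp only [Matrix.add_apply, Matrix.smul_apply, submatrix_apply, h1, h2, smul_eq_mul]
      ring

/-- Every loopless edge set with at most `n` edges has a completion with determinant at least
`(1 - x ^ 2) ^ n`, for `0 ≤ x < 1`. -/
theorem exists_isEdgeCompletion (hx : 0 ≤ x) (hx1 : x < 1) (n : ℕ) :
    ∀ {V : Type u} [Fintype V] [DecidableEq V] (E : Finset (Sym2 V)), (∀ e ∈ E, ¬ e.IsDiag) →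
      E.card ≤ n → ∃ M, IsEdgeCompletion E x ((1 - x ^ 2) ^ n) M := by
  have hq0 : 0 ≤ 1 - x ^ 2 := by nlinarith
  have hq1 : 1 - x ^ 2 ≤ 1 := by nlinarith
  -- The vertex type stays universally quantified, since contraction changes it.
  induction n with
  | zero =>
    intro V _ _ E _ hcard
    obtain rfl : E = ∅ := Finset.card_eq_zero.1 (Nat.le_zero.1 hcard)
    exact ⟨1, PosDef.one, fun i => by simp, fun i j h => by simp at h, by simp⟩
  | succ n ih =>
    intro V _ _ E hE hcard
    have hE' : ∀ f, ∀ e ∈ E.erase f, ¬ e.IsDiag := fun f e he => hE e (Finset.mem_of_mem_erase he)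
    have hcard' : ∀ e ∈ E, (E.erase e).card ≤ n := fun e he => by
      rw [Finset.card_erase_of_mem he]; omega
    by_cases hcase : ∃ i j, s(i, j) ∈ E ∧ ∃ N, IsEdgeCompletion (E.erase s(i, j)) x
        ((1 - x ^ 2) ^ n) N ∧ N i j ≤ x
    · obtain ⟨i, j, hmem, N, hN, hy⟩ := hcase
      have hij : i ≠ j := fun h0 => hE _ hmem (by simpa using h0)
      obtain ⟨e, hei, hej⟩ := exists_equiv_fin_two_sum hij
      obtain ⟨L, hL⟩ := ih ((E.erase s(i, j)).image (Sym2.map (collapsePair _ ∘ e.symm)))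
        (by
          intro f hf
          obtain ⟨g, hg, rfl⟩ := Finset.mem_image.1 hf
          induction g with
          | h a b =>
          intro hd
          have hab : a ≠ b := fun h0 => hE' _ _ hg (by simpa using h0)
          have hs := collapsePair_eq (a := e.symm a) (b := e.symm b) (by simpa using hd)
            (e.symm.injective.ne hab)
          have := congrArg (Sym2.map e) hs
          simp only [Sym2.map_mk, Equiv.apply_symm_apply, hei, hej] at this
          exact (Finset.mem_erase.1 hg).1 this)
        (Finset.card_image_le.trans (hcard' _ hmem))
      rw [pow_succ']
      exact exists_isEdgeCompletion_of_contraction hx hx1 e hei hej hN hy hL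
    · push Not at hcase
      have hex : ∀ e, ∃ (N : Matrix V V ℝ) (y : ℝ), e ∈ E →
          IsEdgeCompletion (E.erase e) x ((1 - x ^ 2) ^ n) N ∧ x < y ∧
            ∀ i j, s(i, j) = e → N i j = y := by
        intro e
        induction e with
        | h a b =>
        by_cases he : s(a, b) ∈ E
        · obtain ⟨N, hN⟩ := ih _ (hE' s(a, b)) (hcard' _ he)
          refine ⟨N, N a b, fun _ => ⟨hN, hcase a b he N hN, fun i j hij => ?_⟩⟩
          rcases Sym2.eq_iff.1 hij with ⟨rfl, rfl⟩ | ⟨rfl, rfl⟩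
          · rfl
          · exact hN.posDef.isHermitian.apply _ _
        · exact ⟨0, 0, fun h => absurd h he⟩
      choose N y hNy using hex
      obtain ⟨M, hM⟩ := exists_isEdgeCompletion_of_forall_lt hx (pow_le_one₀ hq0 hq1) hE N y
        (fun e he => (hNy e he).1) (fun e he => (hNy e he).2.1)
        (fun i j h => (hNy _ h).2.2 i j rfl)
      -- Averaging preserves the bound with exponent `n`, which is stronger than needed.
      exact ⟨M, hM.posDef, hM.diag, hM.edge,
        (pow_le_pow_of_le_one hq0 hq1 n.le_succ).trans hM.le_det⟩

theorem exists_mem_detFeasible_of_nonneg {V : Type u} [Fintype V] [DecidableEq V]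
    (G : SimpleGraph V) [DecidableRel G.Adj] {x : ℝ} (hx : 0 ≤ x) (hx1 : x < 1) :
    ∃ M ∈ detFeasible G x, (1 - x ^ 2) ^ G.edgeFinset.card ≤ M.det := by
  obtain ⟨M, hM⟩ := exists_isEdgeCompletion hx hx1 _ G.edgeFinset
    (fun e he => G.not_isDiag_of_mem_edgeFinset he) le_rfl
  exact ⟨M, ⟨hM.posDef, hM.diag, fun i j h => hM.edge i j (by simpa using h)⟩, hM.le_det⟩

variable {G : SimpleGraph V}

/-! ### Bipartite sign change -/

/-- Conjugation by the signs of a two-colouring replaces `x` by `-x`. -/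
theorem exists_mem_detFeasible_neg (hG : G.IsBipartite) {M : Matrix V V ℝ}
    (hM : M ∈ detFeasible G x) : ∃ N ∈ detFeasible G (-x), N.det = M.det := by
  obtain ⟨c⟩ := hG
  set ε : V → ℝ := fun v => if c v = 0 then 1 else -1 with hε
  have hε2 : ∀ v, ε v * ε v = 1 := fun v => by simp only [hε]; split_ifs <;> norm_num
  have hεadj : ∀ i j, G.Adj i j → ε i * ε j = -1 := by
    intro i j hij
    have := c.valid hij
    simp only [hε]
    split_ifs with h1 h2 h2
    · exact absurd (h1.trans h2.symm) this
    · norm_num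
    · norm_num
    · exact absurd (by omega : c i = c j) this
  have hD : diagonal ε * diagonal ε = (1 : Matrix V V ℝ) := by
    rw [diagonal_mul_diagonal]; simp [hε2]
  have hu : IsUnit (diagonal ε) := IsUnit.of_mul_eq_one_right _ hD
  have hstar : star (diagonal ε) = diagonal ε := by
    rw [star_eq_conjTranspose, diagonal_conjTranspose]; simp
  have happ : ∀ i j, (diagonal ε * M * diagonal ε) i j = ε i * ε j * M i j := fun i j => by
    rw [mul_diagonal, diagonal_mul]; ring
  refine ⟨diagonal ε * M * diagonal ε, ⟨?_, fun i => ?_, fun i j hij => ?_⟩, ?_⟩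
  · have := hu.posDef_star_left_conjugate_iff.2 hM.1
    rwa [hstar] at this
  · rw [happ, hε2, hM.2.1, one_mul]
  · rw [happ, hεadj i j hij, hM.2.2 i j hij, neg_one_mul]
  · rw [det_mul, det_mul, mul_right_comm, ← det_mul, hD, det_one, one_mul]

theorem exists_mem_detFeasible_of_isBipartite [DecidableRel G.Adj] (hG : G.IsBipartite)
    (hx : x ∈ Set.Ioo (-1 : ℝ) 1) :
    ∃ M ∈ detFeasible G x, (1 - x ^ 2) ^ G.edgeFinset.card ≤ M.det := by
  rcases le_total 0 x with h | h
  · exact exists_mem_detFeasible_of_nonneg G h hx.2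
  · obtain ⟨M, hM, hdet⟩ := exists_mem_detFeasible_of_nonneg G (neg_nonneg.2 h)
      (by linarith [hx.1])
    obtain ⟨N, hN, hNM⟩ := exists_mem_detFeasible_neg hG hM
    exact ⟨N, by simpa using hN, by rw [hNM]; simpa using hdet⟩

/-! ### Existence and uniqueness of the maximizer -/

theorem Matrix.PosSemidef.abs_apply_le_one {M : Matrix V V ℝ} (hM : M.PosSemidef)
    (h1 : ∀ i, M i i = 1) (i j : V) : |M i j| ≤ 1 := by
  have hd := (hM.submatrix ![i, j]).det_nonneg
  rw [det_fin_two] at hd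
  have hs : M j i = M i j := hM.isHermitian.apply _ _
  simp [h1, hs] at hd
  exact abs_le_one_iff_mul_self_le_one.2 (by linarith)

/-- A nonempty feasible set contains a matrix of maximal determinant. -/
theorem exists_isDetMaximizer (hne : (detFeasible G x).Nonempty) :
    ∃ A, IsDetMaximizer G x A := by
  -- Relaxing to positive semidefinite matrices gives a compact set; its maximizer has positive
  -- determinant, hence is positive definite.
  set K : Set (Matrix V V ℝ) :=
    {M | M.PosSemidef ∧ (∀ i, M i i = 1) ∧ ∀ i j, G.Adj i j → M i j = x} with hK
  have hent : ∀ i j, Continuous fun M : Matrix V V ℝ => M i j := fun i j =>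
    continuous_id.matrix_elem i j
  have hsub : K ⊆ Set.univ.pi fun _ : V => Set.univ.pi fun _ : V => Set.Icc (-1 : ℝ) 1 :=
    fun M hM i _ j _ => abs_le.1 (hM.1.abs_apply_le_one hM.2.1 i j)
  have hpsd : IsClosed {M : Matrix V V ℝ | M.PosSemidef} := by
    have : {M : Matrix V V ℝ | M.PosSemidef} =
        {M | Mᴴ = M} ∩ ⋂ v : V → ℝ, {M | 0 ≤ star v ⬝ᵥ (M *ᵥ v)} := by
      ext M; simp [posSemidef_iff_dotProduct_mulVec, IsHermitian]
    rw [this]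
    refine (isClosed_eq (by fun_prop) continuous_id).inter (isClosed_iInter fun v => ?_)
    exact isClosed_le continuous_const (by fun_prop)
  have hclosed : IsClosed K := by
    have : K = {M | M.PosSemidef} ∩ ((⋂ i, {M | M i i = 1}) ∩
        ⋂ i, ⋂ j, ⋂ _ : G.Adj i j, {M | M i j = x}) := by
      ext M; simp [hK]
    rw [this]
    exact hpsd.inter ((isClosed_iInter fun i => isClosed_eq (hent i i) continuous_const).inter
      (isClosed_iInter fun i => isClosed_iInter fun j => isClosed_iInter fun _ =>
        isClosed_eq (hent i j) continuous_const))
  have hcomp : IsCompact K :=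
    (isCompact_univ_pi fun _ => isCompact_univ_pi fun _ => isCompact_Icc).of_isClosed_subset
      hclosed hsub
  obtain ⟨M, hM⟩ := hne
  have hmem : ∀ B ∈ detFeasible G x, B ∈ K := fun B hB => ⟨hB.1.posSemidef, hB.2⟩
  obtain ⟨A, hA, hmax⟩ := hcomp.exists_isMaxOn ⟨M, hmem M hM⟩
    (continuous_id.matrix_det.continuousOn)
  have hle : ∀ B ∈ detFeasible G x, B.det ≤ A.det := fun B hB => hmax (hmem B hB)
  have hpos : 0 < A.det := hM.1.det_pos.trans_le (hle M hM)
  exact ⟨A, ⟨hA.1.posDef_iff_det_ne_zero.2 hpos.ne', hA.2⟩, hle⟩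

theorem IsDetMaximizer.unique {A B : Matrix V V ℝ} (hA : IsDetMaximizer G x A)
    (hB : IsDetMaximizer G x B) : A = B := by
  refine hA.1.1.eq_of_det_midpoint_le hB.1.1 (hB.2 A hA.1) (hA.2 _ ⟨?_, fun i => ?_, ?_⟩)
  · exact (hA.1.1.smul (by norm_num)).add (hB.1.1.smul (by norm_num))
  · simp [hA.1.2.1, hB.1.2.1]; norm_num
  · intro i j hij
    simp [hA.1.2.2 i j hij, hB.1.2.2 i j hij]; ring

theorem isDetMaximizer_detMaximizer (h : ∃ A, IsDetMaximizer G x A) :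
    IsDetMaximizer G x (detMaximizer G x) := by
  rw [detMaximizer, dif_pos h]
  exact h.choose_spec

end Completion

theorem theorem2 {V : Type*} [Fintype V] [DecidableEq V] (G : SimpleGraph V)
    [DecidableRel G.Adj] (hG : G.IsBipartite) (x : ℝ) (hx : x ∈ Set.Ioo (-1 : ℝ) 1) :
    (∃! A : Matrix V V ℝ, IsDetMaximizer G x A) ∧
      (1 - x ^ 2) ^ G.edgeFinset.card ≤ tau G x := by
  obtain ⟨M, hM, hdet⟩ := exists_mem_detFeasible_of_isBipartite hG hx
  obtain ⟨A, hA⟩ := exists_isDetMaximizer ⟨M, hM⟩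
  exact ⟨⟨A, hA, fun B hB => hB.unique hA⟩,
    hdet.trans ((isDetMaximizer_detMaximizer ⟨A, hA⟩).2 M hM)⟩
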